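/- Let $N\ge 1$ and let $\Omega\subset\mathbb R^N$ be a bounded smooth domain (non-empty, open, connected, bounded, with $C^\infty$ boundary). Let $w\in C(\overline\Omega)\cap C^\infty(\Omega)$ satisfy $w>0$ in $\Omega$ and $w=0$ on $\Gamma$, where $\Gamma\subset\partial\Omega$ is a relatively open subset or a single point, and let $w$ be an $A_2$ weight on $\Omega$: there is $c>0$ with $$\Big(\frac1{|K|}\int_K w\,dx\Big)\Big(\frac1{|K|}\int_K w^{-1}\,dx\Big)\le c$$ for all cubes $K\subset\Omega$ with sides parallel to the axes. Let $H^1(\Omega;w)$ be the space of real $u\in L^2(\Omega)$ having a weak gradient with $\int_\Omega|\nabla u|^2w\,dx<\infty$, normed by $\|u\|_{H^1(\Omega;w)}^2=\int_\Omega|\nabla u|^2w\,dx+\int_\Omega u^2\,dx$, and let $H^1_0(\Omega;w)$ be the closure of $C_0^\infty(\Omega)$ in it. Assume: 1. there is $C>0$ with $\int_\Omega u^2\,dx\le C\int_\Omega|\nabla u|^2w\,dx$ for all $u\in H_0^1(\Omega;w)$; 2. $H_0^1(\Omega;w)$ embeds continuously into $W^{1,1}(\Omega)$; 3. $H_0^1(\Omega;w)$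 embeds compactly into $L^2(\Omega)$. Let $\mathcal A u=\operatorname{div}(w\nabla u)$ (in the weak sense) with domain $H^1_0(\Omega;w)\cap H^2(\Omega;w)$, where $H^2(\Omega;w)=\{u\in H^1(\Omega;w):\operatorname{div}(w\nabla u)\in L^2(\Omega)\}$. For $\rho\in L^\infty(\Omega)$, a number $\lambda\in\mathbb R$ is an eigenvalue of $\mathcal A+\rho$ if $\ker(\mathcal A+\rho+\lambda)\ne\{0\}$, and it is simple if this kernel is one-dimensional. Then the set $$\{\rho\in L^\infty(\Omega):\ \text{every eigenvalue of }\mathcal A+\rho\text{ is simple}\}$$ contains a residual subset of $(L^\infty(\Omega),|\cdot|_\infty)$, that is, a countable intersection of open dense subsets of $L^\infty(\Omega)$. -/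

import Mathlib

open MeasureTheory Set Filter Topology
open scoped ENNReal NNReal ContDiff InnerProductSpace

namespace DegenerateElliptic

/-- A set `Ω` has smooth boundary: near every boundary point it is the sublevel set `{φ < 0}`
of a smooth function `φ` without critical points. -/
def HasSmoothBoundary {N : ℕ} (Ω : Set (EuclideanSpace ℝ (Fin N))) : Prop :=
  ∀ x₀ ∈ frontier Ω, ∃ (U : Set (EuclideanSpace ℝ (Fin N)))
    (φ : EuclideanSpace ℝ (Fin N) → ℝ), IsOpen U ∧ x₀ ∈ U ∧ ContDiffOn ℝ ∞ φ U ∧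
      (∀ x ∈ U, fderiv ℝ φ x ≠ 0) ∧ ∀ x ∈ U, x ∈ Ω ↔ φ x < 0

/-- A bounded smooth domain: a non-empty connected bounded open set with smooth boundary. -/
structure IsBoundedSmoothDomain {N : ℕ} (Ω : Set (EuclideanSpace ℝ (Fin N))) : Prop where
  isOpen : IsOpen Ω
  isConnected : IsConnected Ω
  isBounded : Bornology.IsBounded Ω
  smooth : HasSmoothBoundary Ω

/-- The closed cube with centre `a`, sides parallel to the axes, and half side length `r`. -/
def cube {N : ℕ} (a : EuclideanSpace ℝ (Fin N)) (r : ℝ) : Set (EuclideanSpace ℝ (Fin N)) :=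
  {x | ∀ i, |x i - a i| ≤ r}

/-- `w` is an `A₂` weight on `Ω`: it is non-negative and locally integrable on `Ω` and the product
of the mean values of `w` and of `1 / w` is bounded uniformly over the cubes contained in `Ω`.
For `Ω = univ` this is the Muckenhoupt class on the whole space. -/
def IsA2WeightOn {N : ℕ} (Ω : Set (EuclideanSpace ℝ (Fin N)))
    (w : EuclideanSpace ℝ (Fin N) → ℝ) : Prop :=
  (∀ x ∈ Ω, 0 ≤ w x) ∧ LocallyIntegrableOn w Ω ∧
    ∃ c : ℝ≥0, ∀ (a : EuclideanSpace ℝ (Fin N)) (r : ℝ), 0 < r → cube a r ⊆ Ω →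
      (⨍⁻ x in cube a r, ENNReal.ofReal (w x) ∂volume) *
        (⨍⁻ x in cube a r, (ENNReal.ofReal (w x))⁻¹ ∂volume) ≤ c

/-- The real Hilbert space `L²(Ω)`. -/
abbrev L2 {N : ℕ} (Ω : Set (EuclideanSpace ℝ (Fin N))) : Type :=
  Lp ℝ 2 (volume.restrict Ω)

/-- The real Banach space `L^∞(Ω)` with the essential supremum norm. -/
abbrev LInf {N : ℕ} (Ω : Set (EuclideanSpace ℝ (Fin N))) : Type :=
  Lp ℝ ∞ (volume.restrict Ω)

/-- The measure `w dx` on `Ω`. -/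
noncomputable def weightedMeasure {N : ℕ} (Ω : Set (EuclideanSpace ℝ (Fin N)))
    (w : EuclideanSpace ℝ (Fin N) → ℝ) : Measure (EuclideanSpace ℝ (Fin N)) :=
  (volume.restrict Ω).withDensity (fun x => ENNReal.ofReal (w x))

/-- `ψ` belongs to `C_0^∞(Ω)`. -/
def IsTestFunction {N : ℕ} (Ω : Set (EuclideanSpace ℝ (Fin N)))
    (ψ : EuclideanSpace ℝ (Fin N) → ℝ) : Prop :=
  ContDiff ℝ ∞ ψ ∧ HasCompactSupport ψ ∧ tsupport ψ ⊆ Ω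

/-- `G` is the weak gradient of `u` on `Ω`. -/
def HasWeakGradient {N : ℕ} (Ω : Set (EuclideanSpace ℝ (Fin N)))
    (u : EuclideanSpace ℝ (Fin N) → ℝ)
    (G : EuclideanSpace ℝ (Fin N) → EuclideanSpace ℝ (Fin N)) : Prop :=
  LocallyIntegrableOn u Ω ∧ LocallyIntegrableOn G Ω ∧
    ∀ ψ : EuclideanSpace ℝ (Fin N) → ℝ, IsTestFunction Ω ψ → ∀ v : EuclideanSpace ℝ (Fin N),
      ∫ x in Ω, u x * fderiv ℝ ψ x v = - ∫ x in Ω, ⟪G x, v⟫_ℝ * ψ x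

/-- `f` is the weak divergence of the vector field `V` on `Ω`. -/
def HasWeakDivergence {N : ℕ} (Ω : Set (EuclideanSpace ℝ (Fin N)))
    (V : EuclideanSpace ℝ (Fin N) → EuclideanSpace ℝ (Fin N))
    (f : EuclideanSpace ℝ (Fin N) → ℝ) : Prop :=
  LocallyIntegrableOn V Ω ∧ LocallyIntegrableOn f Ω ∧
    ∀ ψ : EuclideanSpace ℝ (Fin N) → ℝ, IsTestFunction Ω ψ →
      ∫ x in Ω, ⟪V x, gradient ψ x⟫_ℝ = - ∫ x in Ω, f x * ψ x

/-- `u ∈ H¹(Ω; w)` with weak gradient `G`: here `u ∈ L²(Ω)` and `∫ |G|² w dx < ∞`. -/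
def IsH1Pair {N : ℕ} (Ω : Set (EuclideanSpace ℝ (Fin N)))
    (w : EuclideanSpace ℝ (Fin N) → ℝ) (u : L2 Ω)
    (G : EuclideanSpace ℝ (Fin N) → EuclideanSpace ℝ (Fin N)) : Prop :=
  HasWeakGradient Ω u G ∧ MemLp G 2 (weightedMeasure Ω w)

/-- `u ∈ H_0^1(Ω; w)` with weak gradient `G`: the function `u` lies in `H¹(Ω; w)` and is the
limit, in the norm of that space, of a sequence of test functions. -/
def IsH10Pair {N : ℕ} (Ω : Set (EuclideanSpace ℝ (Fin N)))
    (w : EuclideanSpace ℝ (Fin N) → ℝ) (u : L2 Ω)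
    (G : EuclideanSpace ℝ (Fin N) → EuclideanSpace ℝ (Fin N)) : Prop :=
  IsH1Pair Ω w u G ∧ ∃ φ : ℕ → EuclideanSpace ℝ (Fin N) → ℝ, (∀ n, IsTestFunction Ω (φ n)) ∧
    Tendsto (fun n => eLpNorm (fun x => φ n x - u x) 2 (volume.restrict Ω)) atTop (𝓝 0) ∧
    Tendsto (fun n => eLpNorm (fun x => gradient (φ n) x - G x) 2 (weightedMeasure Ω w))
      atTop (𝓝 0)

/-- The square `∫ |∇u|² w dx + ∫ u² dx` of the norm of `H¹(Ω; w)`, for `u` with gradient `G`. -/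
noncomputable def h1NormSq {N : ℕ} (Ω : Set (EuclideanSpace ℝ (Fin N)))
    (w : EuclideanSpace ℝ (Fin N) → ℝ) (u : L2 Ω)
    (G : EuclideanSpace ℝ (Fin N) → EuclideanSpace ℝ (Fin N)) : ℝ :=
  (∫ x in Ω, ‖G x‖ ^ 2 * w x) + ∫ x in Ω, (u x) ^ 2

/-- The Poincaré inequality in `H_0^1(Ω; w)`. -/
def PoincareInequality {N : ℕ} (Ω : Set (EuclideanSpace ℝ (Fin N)))
    (w : EuclideanSpace ℝ (Fin N) → ℝ) : Prop :=
  ∃ C : ℝ, 0 < C ∧ ∀ u G, IsH10Pair Ω w u G →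
    ∫ x in Ω, (u x) ^ 2 ≤ C * ∫ x in Ω, ‖G x‖ ^ 2 * w x

/-- The continuous embedding of `H_0^1(Ω; w)` into `W^{1,1}(Ω)`. -/
def EmbedsContinuouslyW11 {N : ℕ} (Ω : Set (EuclideanSpace ℝ (Fin N)))
    (w : EuclideanSpace ℝ (Fin N) → ℝ) : Prop :=
  ∃ C : ℝ, 0 < C ∧ ∀ u G, IsH10Pair Ω w u G → IntegrableOn u Ω ∧ IntegrableOn G Ω ∧
    (∫ x in Ω, |u x|) + ∫ x in Ω, ‖G x‖ ≤ C * √(h1NormSq Ω w u G)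

/-- The compact embedding of `H_0^1(Ω; w)` into `L²(Ω)`: the unit ball of `H_0^1(Ω; w)` is
relatively compact in `L²(Ω)`. -/
def EmbedsCompactlyL2 {N : ℕ} (Ω : Set (EuclideanSpace ℝ (Fin N)))
    (w : EuclideanSpace ℝ (Fin N) → ℝ) : Prop :=
  IsCompact (closure {u : L2 Ω | ∃ G, IsH10Pair Ω w u G ∧ h1NormSq Ω w u G ≤ 1})

/-- The graph of `𝒜 u = div (w ∇u)` with domain `H_0^1(Ω; w) ∩ H²(Ω; w)`: it consists of the pairs
`(u, f)` with `u ∈ H_0^1(Ω; w)` and `f ∈ L²(Ω)` such that `div (w ∇u) = f` weakly on `Ω`. -/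
def InGraph {N : ℕ} (Ω : Set (EuclideanSpace ℝ (Fin N)))
    (w : EuclideanSpace ℝ (Fin N) → ℝ) (u f : L2 Ω) : Prop :=
  ∃ G, IsH10Pair Ω w u G ∧ HasWeakDivergence Ω (fun x => w x • G x) f

section Linearity

variable {N : ℕ} {Ω : Set (EuclideanSpace ℝ (Fin N))} {w : EuclideanSpace ℝ (Fin N) → ℝ}

theorem IsTestFunction.add {φ ψ : EuclideanSpace ℝ (Fin N) → ℝ} (hφ : IsTestFunction Ω φ)
    (hψ : IsTestFunction Ω ψ) : IsTestFunction Ω (φ + ψ) :=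
  ⟨hφ.1.add hψ.1, hφ.2.1.add hψ.2.1,
    (tsupport_add φ ψ).trans (union_subset hφ.2.2 hψ.2.2)⟩

theorem IsTestFunction.smul {φ : EuclideanSpace ℝ (Fin N) → ℝ} (hφ : IsTestFunction Ω φ)
    (c : ℝ) : IsTestFunction Ω (c • φ) :=
  ⟨contDiff_const.smul hφ.1, hφ.2.1.smul_left (f := fun _ => c),
    (tsupport_smul_subset_right (fun _ => c) φ).trans hφ.2.2⟩

theorem IsTestFunction.zero : IsTestFunction Ω (0 : EuclideanSpace ℝ (Fin N) → ℝ) :=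
  ⟨contDiff_const, HasCompactSupport.zero, by simp [tsupport]⟩

theorem gradient_add_apply {φ ψ : EuclideanSpace ℝ (Fin N) → ℝ} (hφ : IsTestFunction Ω φ)
    (hψ : IsTestFunction Ω ψ) (x : EuclideanSpace ℝ (Fin N)) :
    gradient (φ + ψ) x = gradient φ x + gradient ψ x := by
  have h1 := (hφ.1.differentiable (by simp)) x
  have h2 := (hψ.1.differentiable (by simp)) x
  simp only [gradient, fderiv_add h1 h2, map_add]

theorem gradient_smul_apply {φ : EuclideanSpace ℝ (Fin N) → ℝ} (hφ : IsTestFunction Ω φ) (c : ℝ)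
    (x : EuclideanSpace ℝ (Fin N)) :
    gradient (c • φ) x = c • gradient φ x := by
  have h1 := (hφ.1.differentiable (by simp)) x
  simp only [gradient, fderiv_const_smul h1, map_smul]

/-- The pairing of a locally integrable function with a continuous field of functionals whose
support is compact and contained in `Ω` is integrable on `Ω`. -/
theorem integrable_clm_of_compact {F : Type*} [NormedAddCommGroup F] [NormedSpace ℝ F]
    {f : EuclideanSpace ℝ (Fin N) → F} (hf : LocallyIntegrableOn f Ω)
    {g : EuclideanSpace ℝ (Fin N) → (F →L[ℝ] ℝ)} (hg : Continuous g)
    (hc : HasCompactSupport g) (hs : tsupport g ⊆ Ω) :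
    Integrable (fun x => g x (f x)) (volume.restrict Ω) := by
  have h1 : IntegrableOn f (tsupport g) := hf.integrableOn_compact_subset hs hc
  obtain ⟨C, hC⟩ := hg.bounded_above_of_compact_support hc
  have h2 : IntegrableOn (fun x => g x (f x)) (tsupport g) := by
    refine (h1.norm.const_mul C).mono' ?_ (ae_of_all _ fun x => ?_)
    · exact (ContinuousLinearMap.apply ℝ ℝ).flip.aestronglyMeasurable_comp₂
        hg.aestronglyMeasurable h1.aestronglyMeasurable
    · exact ((g x).le_opNorm _).trans (by gcongr; exact hC x)
  have h3 : Integrable (fun x => g x (f x)) volume := by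
    refine (integrableOn_iff_integrable_of_support_subset ?_).1 h2
    intro x hx
    apply subset_tsupport
    intro h0
    apply hx
    simp [h0]
  exact h3.restrict

theorem HasWeakGradient.zero {u : EuclideanSpace ℝ (Fin N) → ℝ}
    (hu : u =ᵐ[volume.restrict Ω] 0) (hl : LocallyIntegrableOn u Ω) : HasWeakGradient Ω u 0 := by
  refine ⟨hl, locallyIntegrableOn_zero, fun ψ _ v => ?_⟩
  rw [integral_eq_zero_of_ae]
  · simp
  · filter_upwards [hu] with x hx
    simp [hx]

theorem HasWeakGradient.congr {u u' : EuclideanSpace ℝ (Fin N) → ℝ}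
    {G : EuclideanSpace ℝ (Fin N) → EuclideanSpace ℝ (Fin N)} (h : HasWeakGradient Ω u G)
    (hu : u' =ᵐ[volume.restrict Ω] u) (hl : LocallyIntegrableOn u' Ω) :
    HasWeakGradient Ω u' G := by
  refine ⟨hl, h.2.1, fun ψ hψ v => ?_⟩
  rw [← h.2.2 ψ hψ v]
  refine integral_congr_ae ?_
  filter_upwards [hu] with x hx
  rw [hx]

theorem HasWeakGradient.add {u u' : EuclideanSpace ℝ (Fin N) → ℝ}
    {G G' : EuclideanSpace ℝ (Fin N) → EuclideanSpace ℝ (Fin N)} (h : HasWeakGradient Ω u G)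
    (h' : HasWeakGradient Ω u' G') : HasWeakGradient Ω (u + u') (G + G') := by
  refine ⟨h.1.add h'.1, h.2.1.add h'.2.1, fun ψ hψ v => ?_⟩
  have hI : ∀ {u : EuclideanSpace ℝ (Fin N) → ℝ}, LocallyIntegrableOn u Ω →
      Integrable (fun x => u x * fderiv ℝ ψ x v) (volume.restrict Ω) := by
    intro u hu
    have hc : Continuous (fderiv ℝ ψ) := hψ.1.continuous_fderiv (by simp)
    have hs : HasCompactSupport (fun x => fderiv ℝ ψ x v) :=
      (hψ.2.1.fderiv (𝕜 := ℝ)).comp_left (g := fun L : _ →L[ℝ] ℝ => L v) rfl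
    have := integrable_clm_of_compact (Ω := Ω) hu
      (g := fun x => (fderiv ℝ ψ x v) • ContinuousLinearMap.id ℝ ℝ)
      ((hc.clm_apply continuous_const).smul continuous_const) hs.smul_right
      ((tsupport_smul_subset_left _ _).trans
        ((tsupport_fderiv_apply_subset ℝ v).trans hψ.2.2))
    simpa [mul_comm] using this
  have hJ : ∀ {G : EuclideanSpace ℝ (Fin N) → EuclideanSpace ℝ (Fin N)},
      LocallyIntegrableOn G Ω → Integrable (fun x => ⟪G x, v⟫_ℝ * ψ x) (volume.restrict Ω) := by
    intro G hG
    have := integrable_clm_of_compact (Ω := Ω) hG (g := fun x => (ψ x) • innerSL ℝ v)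
      (hψ.1.continuous.smul continuous_const) hψ.2.1.smul_right
      ((tsupport_smul_subset_left _ _).trans hψ.2.2)
    simpa [mul_comm, real_inner_comm] using this
  simp only [Pi.add_apply, add_mul, inner_add_left]
  rw [integral_add (hI h.1) (hI h'.1), integral_add (hJ h.2.1) (hJ h'.2.1), h.2.2 ψ hψ v,
    h'.2.2 ψ hψ v]
  ring

theorem HasWeakGradient.smul {u : EuclideanSpace ℝ (Fin N) → ℝ}
    {G : EuclideanSpace ℝ (Fin N) → EuclideanSpace ℝ (Fin N)} (h : HasWeakGradient Ω u G)
    (c : ℝ) : HasWeakGradient Ω (c • u) (c • G) := by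
  refine ⟨h.1.smul c, h.2.1.smul c, fun ψ hψ v => ?_⟩
  simp only [Pi.smul_apply, smul_eq_mul, real_inner_smul_left, mul_assoc, integral_const_mul,
    h.2.2 ψ hψ v]
  ring

theorem HasWeakDivergence.zero {f : EuclideanSpace ℝ (Fin N) → ℝ}
    (hf : f =ᵐ[volume.restrict Ω] 0) (hl : LocallyIntegrableOn f Ω) :
    HasWeakDivergence Ω (fun _ => 0) f := by
  refine ⟨locallyIntegrableOn_zero, hl, fun ψ _ => ?_⟩
  rw [integral_eq_zero_of_ae (f := fun x => f x * ψ x)]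
  · simp
  · filter_upwards [hf] with x hx
    simp [hx]

theorem HasWeakDivergence.congr {f f' : EuclideanSpace ℝ (Fin N) → ℝ}
    {V : EuclideanSpace ℝ (Fin N) → EuclideanSpace ℝ (Fin N)} (h : HasWeakDivergence Ω V f)
    (hf : f' =ᵐ[volume.restrict Ω] f) (hl : LocallyIntegrableOn f' Ω) :
    HasWeakDivergence Ω V f' := by
  refine ⟨h.1, hl, fun ψ hψ => ?_⟩
  rw [h.2.2 ψ hψ]
  congr 1
  refine integral_congr_ae ?_
  filter_upwards [hf] with x hx
  rw [hx]

theorem HasWeakDivergence.add {f f' : EuclideanSpace ℝ (Fin N) → ℝ}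
    {V V' : EuclideanSpace ℝ (Fin N) → EuclideanSpace ℝ (Fin N)} (h : HasWeakDivergence Ω V f)
    (h' : HasWeakDivergence Ω V' f') : HasWeakDivergence Ω (V + V') (f + f') := by
  refine ⟨h.1.add h'.1, h.2.1.add h'.2.1, fun ψ hψ => ?_⟩
  have hI : ∀ {f : EuclideanSpace ℝ (Fin N) → ℝ}, LocallyIntegrableOn f Ω →
      Integrable (fun x => f x * ψ x) (volume.restrict Ω) := by
    intro f hf
    have := integrable_clm_of_compact (Ω := Ω) hf
      (g := fun x => (ψ x) • ContinuousLinearMap.id ℝ ℝ)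
      (hψ.1.continuous.smul continuous_const) hψ.2.1.smul_right
      ((tsupport_smul_subset_left _ _).trans hψ.2.2)
    simpa [mul_comm] using this
  have hJ : ∀ {V : EuclideanSpace ℝ (Fin N) → EuclideanSpace ℝ (Fin N)},
      LocallyIntegrableOn V Ω →
        Integrable (fun x => ⟪V x, gradient ψ x⟫_ℝ) (volume.restrict Ω) := by
    intro V hV
    have := integrable_clm_of_compact (Ω := Ω) hV (g := fderiv ℝ ψ)
      (hψ.1.continuous_fderiv (by simp)) (hψ.2.1.fderiv (𝕜 := ℝ))
      ((tsupport_fderiv_subset ℝ).trans hψ.2.2)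
    refine this.congr (ae_of_all _ fun x => ?_)
    simp only [gradient]
    rw [real_inner_comm, InnerProductSpace.toDual_symm_apply]
  simp only [Pi.add_apply, add_mul, inner_add_left]
  rw [integral_add (hI h.2.1) (hI h'.2.1), integral_add (hJ h.1) (hJ h'.1), h.2.2 ψ hψ,
    h'.2.2 ψ hψ]
  ring

theorem HasWeakDivergence.smul {f : EuclideanSpace ℝ (Fin N) → ℝ}
    {V : EuclideanSpace ℝ (Fin N) → EuclideanSpace ℝ (Fin N)} (h : HasWeakDivergence Ω V f)
    (c : ℝ) : HasWeakDivergence Ω (c • V) (c • f) := by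
  refine ⟨h.1.smul c, h.2.1.smul c, fun ψ hψ => ?_⟩
  simp only [Pi.smul_apply, smul_eq_mul, real_inner_smul_left, mul_assoc, integral_const_mul,
    h.2.2 ψ hψ]
  ring

theorem L2.locallyIntegrableOn (u : L2 Ω) : LocallyIntegrableOn u Ω := by
  have h : LocallyIntegrable u (volume.restrict Ω) := (Lp.memLp u).locallyIntegrable (by norm_num)
  intro x _
  have hi := h.integrableOn_isCompact (isCompact_closedBall x 1)
  rw [IntegrableOn, Measure.restrict_restrict measurableSet_closedBall] at hi
  exact ⟨Metric.closedBall x 1 ∩ Ω,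
    inter_mem (mem_nhdsWithin_of_mem_nhds (Metric.closedBall_mem_nhds x one_pos))
      self_mem_nhdsWithin, hi⟩

theorem IsH10Pair.zero : IsH10Pair Ω w 0 0 := by
  have h0 : ((0 : L2 Ω) : EuclideanSpace ℝ (Fin N) → ℝ) =ᵐ[volume.restrict Ω] 0 :=
    Lp.coeFn_zero _ _ _
  refine ⟨⟨HasWeakGradient.zero h0 (L2.locallyIntegrableOn _), MemLp.zero⟩, fun _ => 0,
    fun _ => IsTestFunction.zero, ?_, ?_⟩
  · have : eLpNorm (fun x => (0 : ℝ) - (0 : L2 Ω) x) 2 (volume.restrict Ω) = 0 := by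
      rw [eLpNorm_congr_ae (g := 0)]
      · simp
      · filter_upwards [h0] with x hx
        simp only [hx, Pi.zero_apply, sub_self]
    exact (tendsto_congr fun _ => this).2 tendsto_const_nhds
  · simp [gradient]

theorem weightedMeasure_ac : weightedMeasure Ω w ≪ volume.restrict Ω :=
  withDensity_absolutelyContinuous _ _

theorem IsTestFunction.aestronglyMeasurable_gradient {φ : EuclideanSpace ℝ (Fin N) → ℝ}
    (hφ : IsTestFunction Ω φ) (μ : Measure (EuclideanSpace ℝ (Fin N))) :
    AEStronglyMeasurable (gradient φ) μ :=
  ((InnerProductSpace.toDual ℝ _).symm.continuous.comp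
    (hφ.1.continuous_fderiv (by simp))).aestronglyMeasurable

theorem IsH10Pair.add {u u' : L2 Ω}
    {G G' : EuclideanSpace ℝ (Fin N) → EuclideanSpace ℝ (Fin N)} (h : IsH10Pair Ω w u G)
    (h' : IsH10Pair Ω w u' G') : IsH10Pair Ω w (u + u') (G + G') := by
  obtain ⟨⟨hg, hm⟩, φ, hφ, h1, h2⟩ := h
  obtain ⟨⟨hg', hm'⟩, φ', hφ', h1', h2'⟩ := h'
  refine ⟨⟨(hg.add hg').congr (Lp.coeFn_add u u') (L2.locallyIntegrableOn _), hm.add hm'⟩,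
    fun n => φ n + φ' n, fun n => (hφ n).add (hφ' n), ?_, ?_⟩
  · refine tendsto_of_tendsto_of_tendsto_of_le_of_le tendsto_const_nhds
      (by simpa using h1.add h1') (fun n => zero_le) (fun n => ?_)
    have e : (fun x => (φ n + φ' n) x - (u + u' : L2 Ω) x) =ᵐ[volume.restrict Ω]
        (fun x => φ n x - u x) + (fun x => φ' n x - u' x) := by
      filter_upwards [Lp.coeFn_add u u'] with x hx
      simp only [hx, Pi.add_apply]
      ring
    rw [eLpNorm_congr_ae e]
    exact eLpNorm_add_le
      ((hφ n).1.continuous.aestronglyMeasurable.sub (Lp.aestronglyMeasurable u))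
      ((hφ' n).1.continuous.aestronglyMeasurable.sub (Lp.aestronglyMeasurable u')) (by norm_num)
  · refine tendsto_of_tendsto_of_tendsto_of_le_of_le tendsto_const_nhds
      (by simpa using h2.add h2') (fun n => zero_le) (fun n => ?_)
    have e : (fun x => gradient (φ n + φ' n) x - (G + G') x) =
        (fun x => gradient (φ n) x - G x) + (fun x => gradient (φ' n) x - G' x) := by
      funext x
      simp only [gradient_add_apply (hφ n) (hφ' n), Pi.add_apply]
      abel
    rw [e]
    exact eLpNorm_add_le
      (((hφ n).aestronglyMeasurable_gradient _).sub hm.1)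
      (((hφ' n).aestronglyMeasurable_gradient _).sub hm'.1) (by norm_num)

theorem IsH10Pair.smul {u : L2 Ω}
    {G : EuclideanSpace ℝ (Fin N) → EuclideanSpace ℝ (Fin N)} (h : IsH10Pair Ω w u G)
    (c : ℝ) : IsH10Pair Ω w (c • u) (c • G) := by
  obtain ⟨⟨hg, hm⟩, φ, hφ, h1, h2⟩ := h
  refine ⟨⟨(hg.smul c).congr (Lp.coeFn_smul c u) (L2.locallyIntegrableOn _), hm.const_smul c⟩,
    fun n => c • φ n, fun n => (hφ n).smul c, ?_, ?_⟩
  · have e : ∀ n, eLpNorm (fun x => (c • φ n) x - (c • u : L2 Ω) x) 2 (volume.restrict Ω) =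
        ‖c‖ₑ * eLpNorm (fun x => φ n x - u x) 2 (volume.restrict Ω) := by
      intro n
      rw [← eLpNorm_const_smul]
      refine eLpNorm_congr_ae ?_
      filter_upwards [Lp.coeFn_smul c u] with x hx
      simp only [hx, Pi.smul_apply, smul_eq_mul]
      ring
    simp only [e]
    simpa using ENNReal.Tendsto.const_mul h1 (Or.inr (enorm_ne_top (x := c)))
  · have e : ∀ n, eLpNorm (fun x => gradient (c • φ n) x - (c • G) x) 2 (weightedMeasure Ω w) =
        ‖c‖ₑ * eLpNorm (fun x => gradient (φ n) x - G x) 2 (weightedMeasure Ω w) := by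
      intro n
      rw [← eLpNorm_const_smul]
      congr 1
      funext x
      simp only [gradient_smul_apply (hφ n), Pi.smul_apply, smul_sub]
    simp only [e]
    simpa using ENNReal.Tendsto.const_mul h2 (Or.inr (enorm_ne_top (x := c)))

theorem InGraph.zero : InGraph Ω w 0 0 :=
  ⟨0, IsH10Pair.zero, by
    simpa using HasWeakDivergence.zero (Lp.coeFn_zero _ _ _) (L2.locallyIntegrableOn (0 : L2 Ω))⟩

theorem InGraph.add {u f u' f' : L2 Ω} (h : InGraph Ω w u f) (h' : InGraph Ω w u' f') :
    InGraph Ω w (u + u') (f + f') := by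
  obtain ⟨G, hG, hf⟩ := h
  obtain ⟨G', hG', hf'⟩ := h'
  refine ⟨G + G', hG.add hG', ?_⟩
  have := (hf.add hf').congr (Lp.coeFn_add f f') (L2.locallyIntegrableOn _)
  convert this using 1
  funext x
  simp

theorem InGraph.smul {u f : L2 Ω} (h : InGraph Ω w u f) (c : ℝ) :
    InGraph Ω w (c • u) (c • f) := by
  obtain ⟨G, hG, hf⟩ := h
  refine ⟨c • G, hG.smul c, ?_⟩
  have := (hf.smul c).congr (Lp.coeFn_smul c f) (L2.locallyIntegrableOn _)
  convert this using 1
  funext x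
  exact smul_comm (w x) c (G x)

end Linearity

/-- The eigenspace `ker (𝒜 + ρ + lam)` of `𝒜 + ρ`, where `𝒜 u = div (w ∇u)` has domain
`H_0^1(Ω; w) ∩ H²(Ω; w)` and `ρ` acts by multiplication. -/
def eigenspace {N : ℕ} (Ω : Set (EuclideanSpace ℝ (Fin N)))
    (w : EuclideanSpace ℝ (Fin N) → ℝ) (ρ : LInf Ω) (lam : ℝ) : Submodule ℝ (L2 Ω) where
  carrier := {u | ∃ f : L2 Ω, InGraph Ω w u f ∧
    ∀ᵐ x ∂(volume.restrict Ω), f x + ρ x * u x + lam * u x = 0}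
  zero_mem' := by
    refine ⟨0, InGraph.zero, ?_⟩
    filter_upwards [Lp.coeFn_zero ℝ 2 (volume.restrict Ω)] with x hx
    simp only [hx, Pi.zero_apply, mul_zero, add_zero]
  add_mem' := by
    rintro u u' ⟨f, hf, he⟩ ⟨f', hf', he'⟩
    refine ⟨f + f', hf.add hf', ?_⟩
    filter_upwards [he, he', Lp.coeFn_add u u', Lp.coeFn_add f f'] with x h1 h2 h3 h4
    simp only [h3, h4, Pi.add_apply]
    linear_combination h1 + h2
  smul_mem' := by
    rintro c u ⟨f, hf, he⟩
    refine ⟨c • f, hf.smul c, ?_⟩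
    filter_upwards [he, Lp.coeFn_smul c u, Lp.coeFn_smul c f] with x h1 h2 h3
    simp only [h2, h3, Pi.smul_apply, smul_eq_mul]
    linear_combination c * h1

/-- The real number `lam` is an eigenvalue of `𝒜 + ρ`, that is, `ker (𝒜 + ρ + lam) ≠ {0}`. -/
def IsEigenvalue {N : ℕ} (Ω : Set (EuclideanSpace ℝ (Fin N)))
    (w : EuclideanSpace ℝ (Fin N) → ℝ) (ρ : LInf Ω) (lam : ℝ) : Prop :=
  eigenspace Ω w ρ lam ≠ ⊥

/-- Every eigenvalue of `𝒜 + ρ` is simple: its eigenspace is one-dimensional. -/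
def HasSimpleEigenvalues {N : ℕ} (Ω : Set (EuclideanSpace ℝ (Fin N)))
    (w : EuclideanSpace ℝ (Fin N) → ℝ) (ρ : LInf Ω) : Prop :=
  ∀ lam : ℝ, IsEigenvalue Ω w ρ lam → Module.finrank ℝ (eigenspace Ω w ρ lam) = 1

end DegenerateElliptic

/-!
Write `A` for the graph of `u ↦ div (w ∇u)` in `L²(Ω) × L²(Ω)`, and let `ρ ∈ L^∞(Ω)` act by
multiplication. Green's formula, obtained by testing the weak equation with limits of test
functions (`IsInteriorPositive.green`), makes `A` symmetric and bounds the energy of `u` by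
the `L²` norms of `u` and `div (w ∇u)`. Hence `A` is closed (`inGraph_of_tendsto`), and sets bounded
in the graph norm are relatively compact in `L²(Ω)` by the compact embedding
(`isCompactSymmetricGraph`).

For such an operator in a Hilbert space, orthonormal families of eigenvectors of `A + ρ k`, with
`ρ k → ρ` and eigenvalues in `[-n, n]`, converge along subsequences to orthonormal families of
eigenvectors of `A + ρ` (`exists_subseq_orthonormal`). So the set `multLE A M n m` of perturbations
all of whose eigenvalues in `[-n, n]` have multiplicity at most `m` is open. It is dense for
`m = 1`: each `ρ` has finitely many eigenvalues in `[-n, n]`, of bounded multiplicity, and the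
largest multiplicity `m + 1 ≥ 2` can be lowered by a small perturbation
(`multLE_succ_subset_closure`). Indeed, if eigenvalues of multiplicity `m + 1` persisted along
`ρ + t σ` as `t → 0`, then Green's formula for eigenvectors of `ρ` and `ρ + t σ`, divided by `t`,
would show that the quadratic form of `σ` is a multiple of the inner product on an eigenspace of
`A + ρ` of dimension `m + 1` (`mem_scalarOn_of_tendsto`). The directions `σ` with this property form
a proper subspace of `L^∞(Ω)` for every eigenspace of dimension at least two
(`scalarOn_mulL_ne_top`), and finitely many proper subspaces do not cover `L^∞(Ω)`. No existence
theorem for eigenvalues and no unique continuation is needed.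
-/

/-! ### Symmetric operators with compact resolvent and their bounded perturbations -/

/-- The graph `A` of a closed symmetric operator, bounded subsets of whose domain (for the graph
norm) are relatively compact. -/
structure IsCompactSymmetricGraph {H : Type*} [NormedAddCommGroup H] [InnerProductSpace ℝ H]
    (A : Submodule ℝ (H × H)) : Prop where
  symm : ∀ p ∈ A, ∀ q ∈ A, ⟪p.2, q.1⟫_ℝ = ⟪p.1, q.2⟫_ℝ
  isClosed : IsClosed (A : Set (H × H))
  compact : ∀ C : ℝ, ∃ K : Set H, IsCompact K ∧ ∀ p ∈ A, ‖p.1‖ ≤ C → ‖p.2‖ ≤ C → p.1 ∈ K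

namespace IsCompactSymmetricGraph

variable {H R : Type*} [NormedAddCommGroup H] [InnerProductSpace ℝ H]
  [NormedAddCommGroup R] [NormedSpace ℝ R]

/-- The kernel of `A + M ρ + l`, for an operator given by its graph `A`. -/
noncomputable def ker (A : Submodule ℝ (H × H)) (M : R →L[ℝ] H →L[ℝ] H) (ρ : R)
    (l : ℝ) : Submodule ℝ H :=
  A.comap (LinearMap.id.prod (-((M ρ : H →ₗ[ℝ] H) + l • LinearMap.id)))

variable {A : Submodule ℝ (H × H)} {M : R →L[ℝ] H →L[ℝ] H}

/-- The perturbations for which every eigenvalue in `[-n, n]` has multiplicity at most `m`. -/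
def multLE (A : Submodule ℝ (H × H)) (M : R →L[ℝ] H →L[ℝ] H) (n : ℝ) (m : ℕ) : Set R :=
  {ρ | ∀ l ∈ Icc (-n) n, Module.finrank ℝ (ker A M ρ l) ≤ m}

/-- The directions `σ` whose compression to the subspace `E` is a multiple of the identity. -/
def scalarOn (M : R →L[ℝ] H →L[ℝ] H) (E : Submodule ℝ H) : Submodule ℝ R where
  carrier := {σ | ∃ μ : ℝ, ∀ u ∈ E, ∀ v ∈ E, ⟪M σ u, v⟫_ℝ = μ * ⟪u, v⟫_ℝ}
  zero_mem' := ⟨0, by simp⟩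
  add_mem' := by
    rintro σ τ ⟨a, ha⟩ ⟨b, hb⟩
    refine ⟨a + b, fun u hu v hv => ?_⟩
    simp only [map_add, add_apply, inner_add_left, ha u hu v hv, hb u hu v hv]
    ring
  smul_mem' := by
    rintro c σ ⟨a, ha⟩
    refine ⟨c * a, fun u hu v hv => ?_⟩
    simp only [map_smul, smul_apply, real_inner_smul_left, ha u hu v hv]
    ring

/-- A compact set contains only orthonormal families of bounded size, because distinct members of
such a family are at distance `√2`. -/
theorem exists_card_le_of_orthonormal {K : Set H} (hK : IsCompact K) :
    ∃ B : ℕ, ∀ (ι : Type) [Fintype ι] (u : ι → H), Orthonormal ℝ u → (∀ i, u i ∈ K) →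
      Fintype.card ι ≤ B := by
  obtain ⟨t, ht, hKt⟩ := Metric.totallyBounded_iff.1 hK.totallyBounded (1 / 2) (by norm_num)
  refine ⟨t.ncard, fun ι _ u hu hmem => ?_⟩
  have h : ∀ i, ∃ y ∈ t, dist (u i) y < 1 / 2 := fun i => by
    simpa using hKt (hmem i)
  choose y hyt hy using h
  have hinj : Function.Injective y := by
    intro i j hij
    by_contra hne
    have h1 : dist (u i) (u j) < 1 := by
      have := dist_triangle_right (u i) (u j) (y i)
      have h2 := hy i
      have h3 := hy j
      rw [← hij] at h3
      linarith
    have h2 : ‖u i - u j‖ ^ 2 = 2 := by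
      rw [norm_sub_sq_real, hu.1 i, hu.1 j, hu.2 hne]
      norm_num
    rw [dist_eq_norm] at h1
    nlinarith [norm_nonneg (u i - u j)]
  rw [← Nat.card_eq_fintype_card, ← Set.ncard_univ]
  exact Set.ncard_le_ncard_of_injOn y (fun i _ => hyt i) hinj.injOn ht

/-- Green's identity for two eigenvectors of different perturbations. -/
theorem inner_eigenvectors (hA : IsCompactSymmetricGraph A)
    (hM : ∀ σ u v, ⟪M σ u, v⟫_ℝ = ⟪u, M σ v⟫_ℝ) {ρ ρ' : R} {l l' : ℝ}
    {u v : H} (hu : u ∈ ker A M ρ l) (hv : v ∈ ker A M ρ' l') :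
    ⟪M (ρ' - ρ) u, v⟫_ℝ = (l - l') * ⟪u, v⟫_ℝ := by
  have h : ⟪-(M ρ u + l • u), v⟫_ℝ = ⟪u, -(M ρ' v + l' • v)⟫_ℝ := hA.symm _ hu _ hv
  simp only [inner_neg_left, inner_neg_right, inner_add_left, inner_add_right,
    real_inner_smul_left, real_inner_smul_right] at h
  simp only [map_sub, sub_apply, inner_sub_left]
  rw [hM ρ' u v]
  linarith

theorem exists_compact_eigenvectors (hA : IsCompactSymmetricGraph A)
    (n B : ℝ) : ∃ K : Set H, IsCompact K ∧
    ∀ ρ : R, ‖ρ‖ ≤ B → ∀ l ∈ Icc (-n) n, ∀ u ∈ ker A M ρ l, ‖u‖ ≤ 1 → u ∈ K := by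
  obtain ⟨K, hK, h⟩ := hA.compact (max 1 (‖M‖ * B + n))
  refine ⟨K, hK, fun ρ hρ l hl u hu hu1 => h _ hu (hu1.trans (le_max_left _ _)) ?_⟩
  refine le_trans ?_ (le_max_right _ _)
  have h1 : ‖M ρ u‖ ≤ ‖M‖ * B := calc
    ‖M ρ u‖ ≤ ‖M‖ * ‖ρ‖ * ‖u‖ := M.le_opNorm₂ ρ u
    _ ≤ ‖M‖ * B * 1 := by
      have := (norm_nonneg ρ).trans hρ
      gcongr
    _ = _ := mul_one _
  have h2 : ‖l • u‖ ≤ n := by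
    rw [norm_smul, Real.norm_eq_abs]
    have : |l| ≤ n := abs_le.2 hl
    nlinarith [norm_nonneg u, abs_nonneg l]
  change ‖-(M ρ u + l • u)‖ ≤ _
  rw [norm_neg]
  exact (norm_add_le _ _).trans (add_le_add h1 h2)

theorem mem_ker_of_tendsto (hA : IsCompactSymmetricGraph A)
    {ρ : ℕ → R} {l : ℕ → ℝ} {u : ℕ → H} {ρ₀ : R} {l₀ : ℝ} {u₀ : H}
    (hρ : Tendsto ρ atTop (𝓝 ρ₀)) (hl : Tendsto l atTop (𝓝 l₀)) (hu : Tendsto u atTop (𝓝 u₀))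
    (h : ∀ k, u k ∈ ker A M (ρ k) (l k)) : u₀ ∈ ker A M ρ₀ l₀ := by
  have h1 : Tendsto (fun k => M (ρ k) (u k)) atTop (𝓝 (M ρ₀ u₀)) :=
    (M.continuous₂.tendsto (ρ₀, u₀)).comp (hρ.prodMk_nhds hu)
  exact hA.isClosed.mem_of_tendsto (hu.prodMk_nhds (h1.add (hl.smul hu)).neg)
    (Eventually.of_forall h)

/-- Orthonormal families of eigenvectors of converging perturbations, with bounded eigenvalues,
have a subsequence converging to an orthonormal family of eigenvectors of the limit. -/
theorem exists_subseq_orthonormal (hA : IsCompactSymmetricGraph A)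
    {m : ℕ} {n : ℝ} {ρ : ℕ → R} {ρ₀ : R}
    (hρ : Tendsto ρ atTop (𝓝 ρ₀)) {l : ℕ → ℝ} (hl : ∀ k, l k ∈ Icc (-n) n)
    {u : ℕ → Fin m → H} (hu : ∀ k, Orthonormal ℝ (u k))
    (hker : ∀ k i, u k i ∈ ker A M (ρ k) (l k)) :
    ∃ (φ : ℕ → ℕ) (l₀ : ℝ) (u₀ : Fin m → H), StrictMono φ ∧ l₀ ∈ Icc (-n) n ∧
      Tendsto (l ∘ φ) atTop (𝓝 l₀) ∧ Tendsto (u ∘ φ) atTop (𝓝 u₀) ∧ Orthonormal ℝ u₀ ∧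
      ∀ i, u₀ i ∈ ker A M ρ₀ l₀ := by
  obtain ⟨B, hB⟩ := hρ.norm.bddAbove_range
  obtain ⟨K, hK, hmem⟩ := hA.exists_compact_eigenvectors (M := M) n B
  have hc : IsCompact (Icc (-n) n ×ˢ Set.pi univ fun _ : Fin m => K) :=
    isCompact_Icc.prod (isCompact_univ_pi fun _ => hK)
  obtain ⟨⟨l₀, u₀⟩, h₀, φ, hφ, hlim⟩ := hc.tendsto_subseq (x := fun k => (l k, u k)) fun k =>
    ⟨hl k, fun i _ => hmem _ (hB ⟨k, rfl⟩) _ (hl k) _ (hker k i) ((hu k).1 i).le⟩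
  have h1 : Tendsto (l ∘ φ) atTop (𝓝 l₀) := (continuous_fst.tendsto _).comp hlim
  have h2 : Tendsto (u ∘ φ) atTop (𝓝 u₀) := (continuous_snd.tendsto _).comp hlim
  refine ⟨φ, l₀, u₀, hφ, h₀.1, h1, h2, ?_, fun i => ?_⟩
  · rw [orthonormal_iff_ite]
    intro i j
    refine tendsto_nhds_unique
      ((tendsto_pi_nhds.1 h2 i).inner (𝕜 := ℝ) (tendsto_pi_nhds.1 h2 j)) ?_
    simp only [Function.comp_apply, orthonormal_iff_ite.1 (hu _)]
    exact tendsto_const_nhds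
  · exact hA.mem_ker_of_tendsto (hρ.comp hφ.tendsto_atTop) h1 (tendsto_pi_nhds.1 h2 i)
      fun k => hker _ _

theorem finiteDimensional_ker (hA : IsCompactSymmetricGraph A)
    (ρ : R) (l : ℝ) : FiniteDimensional ℝ (ker A M ρ l) := by
  obtain ⟨K, hK, hmem⟩ := hA.exists_compact_eigenvectors (M := M) |l| ‖ρ‖
  have hcl : IsClosed (ker A M ρ l : Set H) := IsSeqClosed.isClosed fun u u₀ h hu =>
    hA.mem_ker_of_tendsto tendsto_const_nhds tendsto_const_nhds hu h
  have hc := hcl.isClosedEmbedding_subtypeVal.isCompact_preimage hK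
  refine FiniteDimensional.of_isCompact_closedBall ℝ (r := 1) one_pos
    (hc.of_isClosed_subset (Metric.isClosed_closedBall (x := (0 : ker A M ρ l))) ?_)
  intro u hu
  exact hmem ρ le_rfl l (abs_le.1 le_rfl) u u.2 (by simpa using hu)

theorem exists_orthonormal_of_le_finrank (hA : IsCompactSymmetricGraph A) {ρ : R} {l : ℝ} {m : ℕ}
    (h : m ≤ Module.finrank ℝ (ker A M ρ l)) :
    ∃ u : Fin m → H, Orthonormal ℝ u ∧ ∀ i, u i ∈ ker A M ρ l := by
  have := hA.finiteDimensional_ker (M := M) ρ l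
  let b := stdOrthonormalBasis ℝ (ker A M ρ l)
  exact ⟨fun i => b (Fin.castLE h i),
    (b.orthonormal.comp_linearIsometry (ker A M ρ l).subtypeₗᵢ).comp _ (Fin.castLE_injective h),
    fun i => (b _).2⟩

theorem linearIndependent_codRestrict {ρ : R} {l : ℝ} {m : ℕ} {u : Fin m → H}
    (hu : Orthonormal ℝ u) (hmem : ∀ i, u i ∈ ker A M ρ l) :
    LinearIndependent ℝ fun i => (⟨u i, hmem i⟩ : ker A M ρ l) :=
  LinearIndependent.of_comp (ker A M ρ l).subtype hu.linearIndependent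

theorem le_finrank_of_orthonormal (hA : IsCompactSymmetricGraph A)
    {ρ : R} {l : ℝ} {m : ℕ} {u : Fin m → H}
    (hu : Orthonormal ℝ u) (hmem : ∀ i, u i ∈ ker A M ρ l) :
    m ≤ Module.finrank ℝ (ker A M ρ l) := by
  have := hA.finiteDimensional_ker (M := M) ρ l
  simpa using (linearIndependent_codRestrict hu hmem).fintype_card_le_finrank

theorem isOpen_multLE (hA : IsCompactSymmetricGraph A)
    (n : ℝ) (m : ℕ) : IsOpen (multLE A M n m) := by
  rw [← isClosed_compl_iff]
  refine IsSeqClosed.isClosed fun ρ ρ₀ h hρ => ?_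
  simp only [multLE, mem_compl_iff, mem_ofPred_eq, not_forall, not_le, exists_prop] at h ⊢
  choose l hl hrank using h
  choose u hu hker using fun k => hA.exists_orthonormal_of_le_finrank (Nat.succ_le_of_lt (hrank k))
  obtain ⟨-, l₀, u₀, -, hl₀, -, -, hu₀, hker₀⟩ := hA.exists_subseq_orthonormal hρ hl hu hker
  exact ⟨l₀, hl₀, hA.le_finrank_of_orthonormal hu₀ hker₀⟩

theorem exists_mem_multLE (hA : IsCompactSymmetricGraph A)
    (ρ : R) (n : ℝ) : ∃ m, ρ ∈ multLE A M n m := by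
  obtain ⟨K, hK, hmem⟩ := hA.exists_compact_eigenvectors (M := M) n ‖ρ‖
  obtain ⟨B, hB⟩ := exists_card_le_of_orthonormal hK
  refine ⟨B, fun l hl => ?_⟩
  obtain ⟨u, hu, hker⟩ := hA.exists_orthonormal_of_le_finrank (M := M) (ρ := ρ) (l := l) le_rfl
  simpa using hB _ u hu fun i => hmem ρ le_rfl l hl _ (hker i) (hu.1 i).le

theorem finite_eigenvalues (hA : IsCompactSymmetricGraph A)
    (hM : ∀ σ u v, ⟪M σ u, v⟫_ℝ = ⟪u, M σ v⟫_ℝ) (ρ : R) (n : ℝ) :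
    {l | l ∈ Icc (-n) n ∧ 0 < Module.finrank ℝ (ker A M ρ l)}.Finite := by
  obtain ⟨K, hK, hmem⟩ := hA.exists_compact_eigenvectors (M := M) n ‖ρ‖
  obtain ⟨B, hB⟩ := exists_card_le_of_orthonormal hK
  by_contra hinf
  obtain ⟨s, hs, hcard⟩ := Set.Infinite.exists_subset_card_eq hinf (B + 1)
  choose u hu hker using fun l : s =>
    hA.exists_orthonormal_of_le_finrank (Nat.succ_le_of_lt (hs l.2).2)
  have hon : Orthonormal ℝ fun l : s => u l 0 := by
    refine ⟨fun l => (hu l).1 0, fun l l' hne => ?_⟩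
    have h := hA.inner_eigenvectors hM (hker l 0) (hker l' 0)
    simp only [sub_self, map_zero, zero_apply, inner_zero_left] at h
    exact (mul_eq_zero.1 h.symm).resolve_left (sub_ne_zero.2 fun h => hne (Subtype.ext h))
  have := hB s _ hon fun l => hmem ρ le_rfl l (hs l.2).1 _ (hker l 0) ((hu l).1 0).le
  simp [hcard] at this

/-- If eigenspaces of the full dimension `m` persist along `ρ + t k • σ` with `t k → 0`, then the
compression of `σ` to a limit eigenspace is a multiple of the identity. -/
theorem mem_scalarOn_of_tendsto (hA : IsCompactSymmetricGraph A)
    (hM : ∀ σ u v, ⟪M σ u, v⟫_ℝ = ⟪u, M σ v⟫_ℝ) {ρ σ : R}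
    {m : ℕ} (hm : 0 < m) {t : ℕ → ℝ} (ht : ∀ k, t k ≠ 0) {l : ℕ → ℝ} {u : ℕ → Fin m → H}
    (hker : ∀ k i, u k i ∈ ker A M (ρ + t k • σ) (l k)) {l₀ : ℝ} {u₀ : Fin m → H}
    (hlim : Tendsto u atTop (𝓝 u₀)) (hu₀ : Orthonormal ℝ u₀)
    (hker₀ : ∀ i, u₀ i ∈ ker A M ρ l₀) (hrank : Module.finrank ℝ (ker A M ρ l₀) = m) :
    σ ∈ scalarOn M (ker A M ρ l₀) := by
  have := hA.finiteDimensional_ker (M := M) ρ l₀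
  have hi : ∀ i, Tendsto (fun k => u k i) atTop (𝓝 (u₀ i)) := tendsto_pi_nhds.1 hlim
  -- The difference quotients of the eigenvalue act as multipliers at every finite stage.
  have hgreen : ∀ k i, ∀ v ∈ ker A M ρ l₀,
      ⟪M σ (u k i), v⟫_ℝ = (l₀ - l k) / t k * ⟪u k i, v⟫_ℝ := by
    intro k i v hv
    have h := hA.inner_eigenvectors hM (hker k i) hv
    have e : ρ - (ρ + t k • σ) = -(t k • σ) := by abel
    rw [e, map_neg, map_smul, neg_apply, smul_apply, inner_neg_left, real_inner_smul_left] at h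
    rw [div_mul_eq_mul_div, eq_div_iff (ht k)]
    linarith
  have hnum : ∀ i, ∀ v : H, Tendsto (fun k => ⟪M σ (u k i), v⟫_ℝ) atTop (𝓝 ⟪M σ (u₀ i), v⟫_ℝ) :=
    fun i v => (((M σ).continuous.tendsto _).comp (hi i)).inner tendsto_const_nhds
  have hden : ∀ i, ∀ v : H, Tendsto (fun k => ⟪u k i, v⟫_ℝ) atTop (𝓝 ⟪u₀ i, v⟫_ℝ) :=
    fun i v => (hi i).inner tendsto_const_nhds
  -- Testing with one limit eigenvector shows that the quotients converge.
  let i₀ : Fin m := ⟨0, hm⟩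
  have h1 : ⟪u₀ i₀, u₀ i₀⟫_ℝ = 1 := by rw [real_inner_self_eq_norm_sq, hu₀.1, one_pow]
  have hμ : Tendsto (fun k => (l₀ - l k) / t k) atTop (𝓝 ⟪M σ (u₀ i₀), u₀ i₀⟫_ℝ) := by
    have h := (hnum i₀ (u₀ i₀)).div (hden i₀ (u₀ i₀)) (by rw [h1]; exact one_ne_zero)
    rw [h1, div_one] at h
    refine h.congr' ?_
    have hne := (hden i₀ (u₀ i₀)).eventually_ne (by rw [h1]; exact one_ne_zero)
    filter_upwards [hne] with k hk
    simp only [Pi.div_apply]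
    rw [hgreen k i₀ _ (hker₀ i₀), mul_div_assoc, div_self hk, mul_one]
  refine ⟨⟪M σ (u₀ i₀), u₀ i₀⟫_ℝ, fun x hx v hv => ?_⟩
  have hbasis : ∀ i, ⟪M σ (u₀ i), v⟫_ℝ = ⟪M σ (u₀ i₀), u₀ i₀⟫_ℝ * ⟪u₀ i, v⟫_ℝ := fun i =>
    tendsto_nhds_unique (hnum i v)
      ((hμ.mul (hden i v)).congr fun k => (hgreen k i v hv).symm)
  -- The limit family spans the eigenspace, by its dimension.
  have hspan : (⟨x, hx⟩ : ker A M ρ l₀) ∈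
      Submodule.span ℝ (range fun i => (⟨u₀ i, hker₀ i⟩ : ker A M ρ l₀)) := by
    have : Nonempty (Fin m) := ⟨i₀⟩
    rw [(linearIndependent_codRestrict hu₀ hker₀).span_eq_top_of_card_eq_finrank
      (by simp [hrank])]
    trivial
  obtain ⟨c, hc⟩ := (Submodule.mem_span_range_iff_exists_fun ℝ).1 hspan
  have hx' : x = ∑ i, c i • u₀ i := by
    simpa using (congrArg (Subtype.val : ker A M ρ l₀ → H) hc).symm
  rw [hx']
  simp only [map_sum, map_smul, sum_inner, real_inner_smul_left, hbasis, Finset.mul_sum]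
  exact Finset.sum_congr rfl fun i _ => by ring

/-- Perturbing by a small multiple of a direction that is not scalar on any eigenspace of the
largest dimension lowers that dimension. -/
theorem multLE_succ_subset_closure (hA : IsCompactSymmetricGraph A)
    (hM : ∀ σ u v, ⟪M σ u, v⟫_ℝ = ⟪u, M σ v⟫_ℝ)
    (hsplit : ∀ E : Submodule ℝ H, FiniteDimensional ℝ E → 2 ≤ Module.finrank ℝ E →
      scalarOn M E ≠ ⊤) (n : ℝ) {m : ℕ} (hm : 1 ≤ m) :
    multLE A M n (m + 1) ⊆ closure (multLE A M n m) := by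
  intro ρ hρ
  set F := {l | l ∈ Icc (-n) n ∧ Module.finrank ℝ (ker A M ρ l) = m + 1}
  have hF : F.Finite := (hA.finite_eigenvalues hM ρ n).subset fun l hl =>
    ⟨hl.1, by rw [hl.2]; exact m.succ_pos⟩
  obtain ⟨σ, hσ⟩ : ∃ σ : R, ∀ l ∈ F, σ ∉ scalarOn M (ker A M ρ l) := by
    classical
    have h := Subspace.biUnion_ne_univ_of_top_notMem
      (s := hF.toFinset.image fun l => scalarOn M (ker A M ρ l)) (by
        intro htop
        obtain ⟨l, hl, hl'⟩ := Finset.mem_image.1 htop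
        have hl := hF.mem_toFinset.1 hl
        exact hsplit _ (hA.finiteDimensional_ker ρ l) (by rw [hl.2]; omega) hl')
    obtain ⟨σ, hσ⟩ := (Set.ne_univ_iff_exists_notMem _).1 h
    exact ⟨σ, fun l hl hmem => hσ (mem_biUnion
      (Finset.mem_coe.2 (Finset.mem_image_of_mem _ (hF.mem_toFinset.2 hl))) hmem)⟩
  by_contra hcl
  let t : ℕ → ℝ := fun k => 1 / ((k : ℝ) + 1)
  have htpos : ∀ k, t k ≠ 0 := fun k => by positivity
  have hlim : Tendsto (fun k => ρ + t k • σ) atTop (𝓝 ρ) := by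
    simpa [t] using (tendsto_one_div_add_atTop_nhds_zero_nat (𝕜 := ℝ)).smul_const σ |>.const_add ρ
  obtain ⟨k₀, hk₀⟩ := eventually_atTop.1
    (hlim.eventually (isClosed_closure.isOpen_compl.mem_nhds hcl))
  have hbad : ∀ k, ∃ l ∈ Icc (-n) n,
      m + 1 ≤ Module.finrank ℝ (ker A M (ρ + t (k + k₀) • σ) l) := by
    intro k
    have : ρ + t (k + k₀) • σ ∉ multLE A M n m := fun h =>
      hk₀ (k + k₀) (Nat.le_add_left _ _) (subset_closure h)
    simpa only [multLE, mem_ofPred_eq, not_forall, not_le, exists_prop, Nat.succ_le_iff] using this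
  choose l hl hrank using hbad
  choose u hu hker using fun k => hA.exists_orthonormal_of_le_finrank (hrank k)
  obtain ⟨φ, l₀, u₀, hφ, hl₀, hllim, hulim, hu₀, hker₀⟩ := hA.exists_subseq_orthonormal
    (hlim.comp (tendsto_add_atTop_nat k₀)) hl hu hker
  have hfr := le_antisymm (hρ l₀ hl₀) (hA.le_finrank_of_orthonormal hu₀ hker₀)
  exact hσ l₀ ⟨hl₀, hfr⟩ (hA.mem_scalarOn_of_tendsto hM m.succ_pos
    (t := fun k => t (φ k + k₀)) (fun k => htpos _) (fun k i => hker (φ k) i) hulim hu₀ hker₀ hfr)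

theorem dense_multLE_one (hA : IsCompactSymmetricGraph A)
    (hM : ∀ σ u v, ⟪M σ u, v⟫_ℝ = ⟪u, M σ v⟫_ℝ)
    (hsplit : ∀ E : Submodule ℝ H, FiniteDimensional ℝ E → 2 ≤ Module.finrank ℝ E →
      scalarOn M E ≠ ⊤) (n : ℝ) : Dense (multLE A M n 1) := by
  have key : ∀ m, multLE A M n (m + 1) ⊆ closure (multLE A M n 1) := by
    intro m
    induction m with
    | zero => exact subset_closure
    | succ m ih =>
      exact (hA.multLE_succ_subset_closure hM hsplit n (Nat.le_add_left 1 m)).trans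
        (closure_minimal ih isClosed_closure)
  intro ρ
  obtain ⟨m, hm⟩ := hA.exists_mem_multLE (M := M) ρ n
  exact key m fun l hl => (hm l hl).trans m.le_succ

end IsCompactSymmetricGraph

/-! ### Pairings of square integrable functions -/

namespace MeasureTheory.MemLp

variable {α E : Type*} [MeasurableSpace α] {μ : Measure α} [NormedAddCommGroup E]
  [InnerProductSpace ℝ E]

theorem integrable_inner_two {F g : α → E} (hF : MemLp F 2 μ) (hg : MemLp g 2 μ) :
    Integrable (fun x => ⟪F x, g x⟫_ℝ) μ := by
  refine (L2.integrable_inner (𝕜 := ℝ) hF.toLp hg.toLp).congr ?_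
  filter_upwards [hF.coeFn_toLp, hg.coeFn_toLp] with x h1 h2
  rw [h1, h2]

theorem inner_toLp_two {F g : α → E} (hF : MemLp F 2 μ) (hg : MemLp g 2 μ) :
    ⟪hF.toLp, hg.toLp⟫_ℝ = ∫ x, ⟪F x, g x⟫_ℝ ∂μ := by
  rw [L2.inner_def]
  refine integral_congr_ae ?_
  filter_upwards [hF.coeFn_toLp, hg.coeFn_toLp] with x h1 h2
  rw [h1, h2]

theorem tendsto_integral_inner {F g : α → E} {G : ℕ → α → E} (hF : MemLp F 2 μ)
    (hg : MemLp g 2 μ) (hG : ∀ n, AEStronglyMeasurable (G n) μ)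
    (h : Tendsto (fun n => eLpNorm (fun x => G n x - g x) 2 μ) atTop (𝓝 0)) :
    Tendsto (fun n => ∫ x, ⟪F x, G n x⟫_ℝ ∂μ) atTop (𝓝 (∫ x, ⟪F x, g x⟫_ℝ ∂μ)) := by
  refine tendsto_integral_of_L1' _ (hF.integrable_inner_two hg).aestronglyMeasurable ?_ ?_
  · filter_upwards [h.eventually_lt_const (u := ⊤) (by simp)] with n hn
    have h1 : MemLp (fun x => G n x - g x) 2 μ := ⟨(hG n).sub hg.1, hn⟩
    refine hF.integrable_inner_two (g := G n) ?_
    convert h1.add hg using 1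
    funext x
    simp
  · have h0 : Tendsto (fun n => eLpNorm F 2 μ * eLpNorm (fun x => G n x - g x) 2 μ) atTop
        (𝓝 0) := by
      simpa using ENNReal.Tendsto.const_mul h (Or.inr hF.2.ne)
    refine tendsto_of_tendsto_of_tendsto_of_le_of_le tendsto_const_nhds h0 (fun _ => zero_le)
      fun n => ?_
    have e : ((fun x => ⟪F x, G n x⟫_ℝ) - fun x => ⟪F x, g x⟫_ℝ) =
        fun x => ⟪F x, G n x - g x⟫_ℝ := by
      funext x
      simp [inner_sub_right]
    simp only [e]
    have hle := eLpNorm_le_eLpNorm_mul_eLpNorm'_of_norm (p := 2) (q := 2) (r := 1) hF.1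
      ((hG n).sub hg.1) (fun a b => ⟪a, b⟫_ℝ) 1
      (ae_of_all _ fun x => by simpa using norm_inner_le_norm (𝕜 := ℝ) (F x) (G n x - g x))
    rw [ENNReal.coe_one, one_mul] at hle
    exact hle

end MeasureTheory.MemLp

namespace DegenerateElliptic

variable {N : ℕ} {Ω : Set (EuclideanSpace ℝ (Fin N))} {w : EuclideanSpace ℝ (Fin N) → ℝ}

/-! ### The weighted measure -/

/-- A weight on a bounded open set that is continuous up to the boundary and positive inside. -/
structure IsInteriorPositive {N : ℕ} (Ω : Set (EuclideanSpace ℝ (Fin N)))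
    (w : EuclideanSpace ℝ (Fin N) → ℝ) : Prop where
  isOpen : IsOpen Ω
  isBounded : Bornology.IsBounded Ω
  continuousOn : ContinuousOn w (closure Ω)
  pos : ∀ x ∈ Ω, 0 < w x

namespace IsInteriorPositive

theorem ae_pos (hw : IsInteriorPositive Ω w) : ∀ᵐ x ∂(volume.restrict Ω), 0 < w x :=
  (ae_restrict_iff' hw.isOpen.measurableSet).2 (ae_of_all _ hw.pos)

theorem aemeasurable (hw : IsInteriorPositive Ω w) :
    AEMeasurable (fun x => ENNReal.ofReal (w x)) (volume.restrict Ω) :=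
  ((hw.continuousOn.mono subset_closure).aemeasurable hw.isOpen.measurableSet).ennreal_ofReal

theorem isFiniteMeasure_restrict (hw : IsInteriorPositive Ω w) :
    IsFiniteMeasure (volume.restrict Ω) :=
  ⟨by simpa using hw.isBounded.measure_lt_top⟩

theorem isFiniteMeasure (hw : IsInteriorPositive Ω w) : IsFiniteMeasure (weightedMeasure Ω w) :=
  isFiniteMeasure_withDensity_ofReal
    ((hw.continuousOn.integrableOn_compact hw.isBounded.isCompact_closure).mono_set
      subset_closure).2

theorem integral_eq {F : Type*} [NormedAddCommGroup F] [NormedSpace ℝ F]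
    (hw : IsInteriorPositive Ω w) (g : EuclideanSpace ℝ (Fin N) → F) :
    ∫ x, g x ∂(weightedMeasure Ω w) = ∫ x in Ω, w x • g x := by
  rw [weightedMeasure, integral_withDensity_eq_integral_toReal_smul₀ hw.aemeasurable (by simp)]
  refine integral_congr_ae ?_
  filter_upwards [hw.ae_pos] with x hx
  rw [ENNReal.toReal_ofReal hx.le]

theorem integrableOn_smul {F : Type*} [NormedAddCommGroup F] [NormedSpace ℝ F]
    (hw : IsInteriorPositive Ω w) {g : EuclideanSpace ℝ (Fin N) → F}
    (hg : MemLp g 2 (weightedMeasure Ω w)) : IntegrableOn (fun x => w x • g x) Ω := by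
  have := hw.isFiniteMeasure
  have h := (integrable_withDensity_iff_integrable_smul₀' hw.aemeasurable (by simp)).1
    (hg.integrable (by norm_num))
  refine h.congr ?_
  filter_upwards [hw.ae_pos] with x hx
  rw [ENNReal.toReal_ofReal hx.le]

/-- Since `1 / w` is locally bounded in `Ω`, weighted square integrability implies local
integrability. -/
theorem locallyIntegrableOn {F : Type*} [NormedAddCommGroup F] [NormedSpace ℝ F]
    (hw : IsInteriorPositive Ω w) {g : EuclideanSpace ℝ (Fin N) → F}
    (hg : MemLp g 2 (weightedMeasure Ω w)) : LocallyIntegrableOn g Ω := by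
  have h := (hw.integrableOn_smul hg).locallyIntegrableOn.continuousOn_smul
    hw.isOpen.isLocallyClosed
    ((hw.continuousOn.mono subset_closure).inv₀ fun x hx => (hw.pos x hx).ne')
  rw [locallyIntegrableOn_iff hw.isOpen.isLocallyClosed] at h ⊢
  intro k hk hkc
  refine (h k hk hkc).congr_fun (fun x hx => ?_) hkc.measurableSet
  simp [smul_smul, inv_mul_cancel₀ (hw.pos x (hk hx)).ne']

/-- A test field divided by the weight is weighted square integrable. -/
theorem memLp_inv_smul_test (hw : IsInteriorPositive Ω w)
    {ψ : EuclideanSpace ℝ (Fin N) → ℝ} (hψ : IsTestFunction Ω ψ) (v : EuclideanSpace ℝ (Fin N)) :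
    MemLp (fun x => ((w x)⁻¹ * ψ x) • v) 2 (weightedMeasure Ω w) := by
  have := hw.isFiniteMeasure
  have hc : ContinuousOn (fun x => ((w x)⁻¹ * ψ x) • v) Ω :=
    (((hw.continuousOn.mono subset_closure).inv₀ fun x hx => (hw.pos x hx).ne').mul
      hψ.1.continuous.continuousOn).smul continuousOn_const
  obtain ⟨C, hC⟩ := hψ.2.1.exists_bound_of_continuousOn (hc.mono hψ.2.2)
  refine MemLp.of_bound ((hc.aestronglyMeasurable hw.isOpen.measurableSet).mono_ac
    weightedMeasure_ac) (max C 0) (ae_of_all _ fun x => ?_)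
  by_cases hx : x ∈ tsupport ψ
  · exact (hC x hx).trans (le_max_left _ _)
  · simp [image_eq_zero_of_notMem_tsupport hx]

theorem memLp_gradient (hw : IsInteriorPositive Ω w)
    {ψ : EuclideanSpace ℝ (Fin N) → ℝ} (hψ : IsTestFunction Ω ψ) :
    MemLp (gradient ψ) 2 (weightedMeasure Ω w) := by
  have := hw.isFiniteMeasure
  obtain ⟨C, hC⟩ := (hψ.1.continuous_fderiv (by simp)).bounded_above_of_compact_support
    (hψ.2.1.fderiv (𝕜 := ℝ))
  exact MemLp.of_bound (hψ.aestronglyMeasurable_gradient _) C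
    (ae_of_all _ fun x => by simpa [gradient] using hC x)

end IsInteriorPositive

theorem IsTestFunction.memLp {ψ : EuclideanSpace ℝ (Fin N) → ℝ} (hψ : IsTestFunction Ω ψ) :
    MemLp ψ 2 (volume.restrict Ω) :=
  (hψ.1.continuous.memLp_of_hasCompactSupport hψ.2.1).restrict _

theorem IsTestFunction.memLp_fderiv {ψ : EuclideanSpace ℝ (Fin N) → ℝ}
    (hψ : IsTestFunction Ω ψ) (v : EuclideanSpace ℝ (Fin N)) :
    MemLp (fun x => fderiv ℝ ψ x v) 2 (volume.restrict Ω) :=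
  (((hψ.1.continuous_fderiv (by simp)).clm_apply continuous_const).memLp_of_hasCompactSupport
    ((hψ.2.1.fderiv (𝕜 := ℝ)).comp_left (g := fun L : _ →L[ℝ] ℝ => L v) rfl)).restrict _

theorem eLpNorm_tendsto_of_tendsto {u : ℕ → L2 Ω} {u₀ : L2 Ω} (h : Tendsto u atTop (𝓝 u₀)) :
    Tendsto (fun n => eLpNorm (fun x => u n x - u₀ x) 2 (volume.restrict Ω)) atTop (𝓝 0) :=
  (Lp.tendsto_Lp_iff_tendsto_eLpNorm' u u₀).1 h

/-! ### Green's formula -/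

/-- Green's formula: the weak equation `div (w ∇u) = f` may be tested with any element of
`H_0^1(Ω; w)`, because test functions are dense there. -/
theorem IsInteriorPositive.green (hw : IsInteriorPositive Ω w) {v f : L2 Ω}
    {G G' : EuclideanSpace ℝ (Fin N) → EuclideanSpace ℝ (Fin N)}
    (hG : MemLp G 2 (weightedMeasure Ω w)) (hf : HasWeakDivergence Ω (fun x => w x • G x) f)
    (hv : IsH10Pair Ω w v G') :
    ∫ x, ⟪G x, G' x⟫_ℝ ∂(weightedMeasure Ω w) = -⟪f, v⟫_ℝ := by
  obtain ⟨⟨-, hG'⟩, φ, hφ, h1, h2⟩ := hv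
  have h3 := hG.tendsto_integral_inner hG' (fun n => (hφ n).aestronglyMeasurable_gradient _) h2
  have h4 := (Lp.memLp f).tendsto_integral_inner (Lp.memLp v)
    (fun n => (hφ n).1.continuous.aestronglyMeasurable) h1
  rw [L2.inner_def]
  refine tendsto_nhds_unique h3 (h4.neg.congr fun n => ?_)
  rw [hw.integral_eq]
  have h5 := hf.2.2 (φ n) (hφ n)
  simp only [real_inner_smul_left] at h5
  simp only [smul_eq_mul, h5]
  congr 1
  refine integral_congr_ae (ae_of_all _ fun x => ?_)
  simp [mul_comm]

/-- The weighted `L²` class of a weak gradient. -/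
noncomputable def IsH10Pair.gradientLp {u : L2 Ω}
    {G : EuclideanSpace ℝ (Fin N) → EuclideanSpace ℝ (Fin N)} (h : IsH10Pair Ω w u G) :
    Lp (EuclideanSpace ℝ (Fin N)) 2 (weightedMeasure Ω w) :=
  h.1.2.toLp G

theorem IsInteriorPositive.inner_gradientLp (hw : IsInteriorPositive Ω w) {u v f : L2 Ω}
    {G G' : EuclideanSpace ℝ (Fin N) → EuclideanSpace ℝ (Fin N)}
    (hu : IsH10Pair Ω w u G) (hf : HasWeakDivergence Ω (fun x => w x • G x) f)
    (hv : IsH10Pair Ω w v G') : ⟪hu.gradientLp, hv.gradientLp⟫_ℝ = -⟪f, v⟫_ℝ :=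
  (MemLp.inner_toLp_two _ _).trans (hw.green hu.1.2 hf hv)

theorem IsInteriorPositive.inner_eq_inner (hw : IsInteriorPositive Ω w) {u f v g : L2 Ω}
    (h : InGraph Ω w u f) (h' : InGraph Ω w v g) : ⟪f, v⟫_ℝ = ⟪u, g⟫_ℝ := by
  obtain ⟨G, hu, hf⟩ := h
  obtain ⟨G', hv, hg⟩ := h'
  have h1 := hw.inner_gradientLp hu hf hv
  have h2 := hw.inner_gradientLp hv hg hu
  rw [real_inner_comm] at h2
  rw [real_inner_comm g u]
  linarith

/-- The energy identity. -/
theorem IsInteriorPositive.h1NormSq_eq (hw : IsInteriorPositive Ω w) {u f : L2 Ω}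
    {G : EuclideanSpace ℝ (Fin N) → EuclideanSpace ℝ (Fin N)}
    (hu : IsH10Pair Ω w u G) (hf : HasWeakDivergence Ω (fun x => w x • G x) f) :
    h1NormSq Ω w u G = -⟪f, u⟫_ℝ + ‖u‖ ^ 2 := by
  rw [h1NormSq, ← hw.green hu.1.2 hf hu, hw.integral_eq, ← real_inner_self_eq_norm_sq u,
    L2.inner_def]
  simp only [real_inner_self_eq_norm_sq, smul_eq_mul, Real.norm_eq_abs, sq_abs, mul_comm]

/-! ### The operator as a closed graph with compact resolvent -/

/-- The graph of `u ↦ div (w ∇u)`, as a subspace of `L²(Ω) × L²(Ω)`. -/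
def graph (Ω : Set (EuclideanSpace ℝ (Fin N))) (w : EuclideanSpace ℝ (Fin N) → ℝ) :
    Submodule ℝ (L2 Ω × L2 Ω) where
  carrier := {p | InGraph Ω w p.1 p.2}
  zero_mem' := InGraph.zero
  add_mem' h h' := h.add h'
  smul_mem' c _ h := h.smul c

/-- The pairs `(u, ∇u)` with `u ∈ H_0^1(Ω; w)` form a closed set. -/
theorem IsInteriorPositive.isH10Pair_of_tendsto (hw : IsInteriorPositive Ω w)
    {u : ℕ → L2 Ω} {u₀ : L2 Ω} (hu : Tendsto u atTop (𝓝 u₀))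
    {G : ℕ → EuclideanSpace ℝ (Fin N) → EuclideanSpace ℝ (Fin N)}
    {G₀ : EuclideanSpace ℝ (Fin N) → EuclideanSpace ℝ (Fin N)}
    (h : ∀ n, IsH10Pair Ω w (u n) (G n)) (hG₀ : MemLp G₀ 2 (weightedMeasure Ω w))
    (hG : Tendsto (fun n => eLpNorm (fun x => G n x - G₀ x) 2 (weightedMeasure Ω w))
      atTop (𝓝 0)) : IsH10Pair Ω w u₀ G₀ := by
  have hu' := eLpNorm_tendsto_of_tendsto hu
  refine ⟨⟨⟨L2.locallyIntegrableOn u₀, hw.locallyIntegrableOn hG₀, fun ψ hψ v => ?_⟩, hG₀⟩, ?_⟩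
  · -- Both sides of the defining identity pass to the limit; the right-hand side is a weighted
    -- pairing with the field `w⁻¹ ψ v`.
    have hconv : ∀ G : EuclideanSpace ℝ (Fin N) → EuclideanSpace ℝ (Fin N),
        ∫ x, ⟪((w x)⁻¹ * ψ x) • v, G x⟫_ℝ ∂(weightedMeasure Ω w) =
          ∫ x in Ω, ⟪G x, v⟫_ℝ * ψ x := by
      intro G
      rw [hw.integral_eq]
      refine integral_congr_ae ?_
      filter_upwards [hw.ae_pos] with x hx
      rw [real_inner_smul_left, real_inner_comm, smul_eq_mul, ← mul_assoc, ← mul_assoc,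
        mul_inv_cancel₀ hx.ne', one_mul, mul_comm]
    have h1 := (hψ.memLp_fderiv v).tendsto_integral_inner (Lp.memLp u₀)
      (fun n => Lp.aestronglyMeasurable (u n)) hu'
    have h2 := (hw.memLp_inv_smul_test hψ v).tendsto_integral_inner hG₀
      (fun n => (h n).1.2.1) hG
    simp only [hconv] at h2
    exact tendsto_nhds_unique h1 (h2.neg.congr fun n => ((h n).1.1.2.2 ψ hψ v).symm)
  · have hex : ∀ n : ℕ, ∃ φ, IsTestFunction Ω φ ∧
        eLpNorm (fun x => φ x - u n x) 2 (volume.restrict Ω) < ((n : ℝ≥0∞) + 1)⁻¹ ∧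
        eLpNorm (fun x => gradient φ x - G n x) 2 (weightedMeasure Ω w) <
          ((n : ℝ≥0∞) + 1)⁻¹ := by
      intro n
      obtain ⟨-, φ, hφ, h1, h2⟩ := h n
      have hpos : (0 : ℝ≥0∞) < ((n : ℝ≥0∞) + 1)⁻¹ := by simp
      obtain ⟨k, hk1, hk2⟩ := ((h1.eventually_lt_const hpos).and
        (h2.eventually_lt_const hpos)).exists
      exact ⟨φ k, hφ k, hk1, hk2⟩
    choose φ hφ h1 h2 using hex
    have hε : Tendsto (fun n : ℕ => ((n : ℝ≥0∞) + 1)⁻¹) atTop (𝓝 0) := by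
      have := (tendsto_add_atTop_iff_nat 1).2 ENNReal.tendsto_inv_nat_nhds_zero
      simpa using this
    refine ⟨φ, hφ, ?_, ?_⟩
    · refine tendsto_of_tendsto_of_tendsto_of_le_of_le tendsto_const_nhds
        (by simpa using hε.add hu') (fun _ => zero_le) fun n => ?_
      have e : (fun x => φ n x - u₀ x) = (fun x => φ n x - u n x) + fun x => u n x - u₀ x := by
        funext x
        simp
      simp only [e]
      exact (eLpNorm_add_le ((hφ n).1.continuous.aestronglyMeasurable.sub
        (Lp.aestronglyMeasurable _)) ((Lp.aestronglyMeasurable _).sub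
        (Lp.aestronglyMeasurable _)) (by norm_num)).trans (add_le_add (h1 n).le le_rfl)
    · refine tendsto_of_tendsto_of_tendsto_of_le_of_le tendsto_const_nhds
        (by simpa using hε.add hG) (fun _ => zero_le) fun n => ?_
      have e : (fun x => gradient (φ n) x - G₀ x) =
          (fun x => gradient (φ n) x - G n x) + fun x => G n x - G₀ x := by
        funext x
        simp
      simp only [e]
      exact (eLpNorm_add_le (((hφ n).aestronglyMeasurable_gradient _).sub (h n).1.2.1)
        ((h n).1.2.1.sub hG₀.1) (by norm_num)).trans (add_le_add (h2 n).le le_rfl)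

theorem IsInteriorPositive.hasWeakDivergence_of_tendsto (hw : IsInteriorPositive Ω w)
    {f : ℕ → L2 Ω} {f₀ : L2 Ω} (hf : Tendsto f atTop (𝓝 f₀))
    {G : ℕ → EuclideanSpace ℝ (Fin N) → EuclideanSpace ℝ (Fin N)}
    {G₀ : EuclideanSpace ℝ (Fin N) → EuclideanSpace ℝ (Fin N)}
    (h : ∀ n, HasWeakDivergence Ω (fun x => w x • G n x) (f n))
    (hGm : ∀ n, AEStronglyMeasurable (G n) (weightedMeasure Ω w))
    (hG₀ : MemLp G₀ 2 (weightedMeasure Ω w))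
    (hG : Tendsto (fun n => eLpNorm (fun x => G n x - G₀ x) 2 (weightedMeasure Ω w))
      atTop (𝓝 0)) : HasWeakDivergence Ω (fun x => w x • G₀ x) f₀ := by
  refine ⟨(hw.integrableOn_smul hG₀).locallyIntegrableOn, L2.locallyIntegrableOn f₀,
    fun ψ hψ => ?_⟩
  have hconv : ∀ G : EuclideanSpace ℝ (Fin N) → EuclideanSpace ℝ (Fin N),
      ∫ x, ⟪gradient ψ x, G x⟫_ℝ ∂(weightedMeasure Ω w) =
        ∫ x in Ω, ⟪w x • G x, gradient ψ x⟫_ℝ := by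
    intro G
    rw [hw.integral_eq]
    refine integral_congr_ae (ae_of_all _ fun x => ?_)
    simp only [real_inner_smul_left, smul_eq_mul]
    rw [real_inner_comm]
  have h1 := hψ.memLp.tendsto_integral_inner (Lp.memLp f₀)
    (fun n => Lp.aestronglyMeasurable (f n)) (eLpNorm_tendsto_of_tendsto hf)
  have h2 := (hw.memLp_gradient hψ).tendsto_integral_inner hG₀ hGm hG
  simp only [hconv] at h2
  exact tendsto_nhds_unique h2 (h1.neg.congr fun n => ((h n).2.2 ψ hψ).symm)

/-- The graph of the operator is closed: by Green's formula, convergence of `u n` and of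
`div (w ∇(u n))` in `L²(Ω)` makes the gradients a Cauchy sequence in the weighted space. -/
theorem IsInteriorPositive.inGraph_of_tendsto (hw : IsInteriorPositive Ω w)
    {u f : ℕ → L2 Ω} {u₀ f₀ : L2 Ω} (h : ∀ n, InGraph Ω w (u n) (f n))
    (hu : Tendsto u atTop (𝓝 u₀)) (hf : Tendsto f atTop (𝓝 f₀)) : InGraph Ω w u₀ f₀ := by
  choose G hG hdiv using h
  let g := fun n => (hG n).gradientLp
  have hnorm : ∀ n k, ‖g n - g k‖ ^ 2 ≤ ‖f n - f k‖ * ‖u n - u k‖ := by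
    intro n k
    have e : ‖g n - g k‖ ^ 2 = -⟪f n - f k, u n - u k⟫_ℝ := by
      have h1 := hw.inner_gradientLp (hG n) (hdiv n) (hG n)
      have h2 := hw.inner_gradientLp (hG n) (hdiv n) (hG k)
      have h3 := hw.inner_gradientLp (hG k) (hdiv k) (hG n)
      have h4 := hw.inner_gradientLp (hG k) (hdiv k) (hG k)
      rw [← real_inner_self_eq_norm_sq]
      simp only [inner_sub_left, inner_sub_right, g, h1, h2, h3, h4]
      ring
    rw [e]
    exact (neg_le_abs _).trans (abs_real_inner_le_norm _ _)
  have hcauchy : CauchySeq g := by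
    rw [Metric.cauchySeq_iff]
    intro ε hε
    obtain ⟨a, ha⟩ := Metric.cauchySeq_iff.1 hu.cauchySeq ε hε
    obtain ⟨b, hb⟩ := Metric.cauchySeq_iff.1 hf.cauchySeq ε hε
    refine ⟨max a b, fun n hn k hk => ?_⟩
    have h1 := ha n (le_of_max_le_left hn) k (le_of_max_le_left hk)
    have h2 := hb n (le_of_max_le_right hn) k (le_of_max_le_right hk)
    rw [dist_eq_norm] at h1 h2 ⊢
    refine lt_of_pow_lt_pow_left₀ 2 hε.le ((hnorm n k).trans_lt ?_)
    rw [sq]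
    exact mul_lt_mul'' h2 h1 (norm_nonneg _) (norm_nonneg _)
  obtain ⟨g₀, hg₀⟩ := cauchySeq_tendsto_of_complete hcauchy
  have hlim : Tendsto (fun n => eLpNorm (fun x => G n x - g₀ x) 2 (weightedMeasure Ω w))
      atTop (𝓝 0) := by
    refine ((Lp.tendsto_Lp_iff_tendsto_eLpNorm' g g₀).1 hg₀).congr fun n => ?_
    refine eLpNorm_congr_ae ?_
    filter_upwards [(hG n).1.2.coeFn_toLp] with x hx
    simp only [Pi.sub_apply, g, IsH10Pair.gradientLp, hx]
  exact ⟨g₀, hw.isH10Pair_of_tendsto hu hG (Lp.memLp g₀) hlim,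
    hw.hasWeakDivergence_of_tendsto hf hdiv (fun n => (hG n).1.2.1) (Lp.memLp g₀) hlim⟩

theorem IsInteriorPositive.isCompactSymmetricGraph (hw : IsInteriorPositive Ω w)
    (hc : EmbedsCompactlyL2 Ω w) : IsCompactSymmetricGraph (graph Ω w) where
  symm _ hp _ hq := hw.inner_eq_inner hp hq
  isClosed := IsSeqClosed.isClosed fun p p₀ hp hlim =>
    hw.inGraph_of_tendsto hp ((continuous_fst.tendsto _).comp hlim)
      ((continuous_snd.tendsto _).comp hlim)
  compact C := by
    -- After division by `2 |C| + 1` the energy is at most `1 / 4 + 1 / 4`.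
    set r : ℝ := 2 * |C| + 1
    have hr : 0 < r := by positivity
    refine ⟨_, hc.image (continuous_const_smul r), fun p hp h1 h2 => ?_⟩
    refine ⟨r⁻¹ • p.1, subset_closure ?_, by simp [smul_smul, mul_inv_cancel₀ hr.ne']⟩
    obtain ⟨G, hu, hf⟩ := InGraph.smul hp r⁻¹
    refine ⟨G, hu, ?_⟩
    have hle : ∀ v : L2 Ω, ‖v‖ ≤ C → ‖r⁻¹ • v‖ ≤ 1 / 2 := by
      intro v hv
      rw [norm_smul, norm_inv, Real.norm_eq_abs, abs_of_pos hr, inv_mul_le_iff₀ hr]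
      have := le_abs_self C
      simp only [r]
      linarith
    have h3 := hle _ h1
    have h4 := hle _ h2
    rw [hw.h1NormSq_eq hu hf]
    have h5 := (neg_le_abs _).trans (abs_real_inner_le_norm (r⁻¹ • p.2) (r⁻¹ • p.1))
    nlinarith [norm_nonneg (r⁻¹ • p.1), norm_nonneg (r⁻¹ • p.2)]

/-! ### Multiplication by bounded functions -/

/-- Multiplication `L^∞(Ω) × L²(Ω) → L²(Ω)`. -/
noncomputable def mulL (Ω : Set (EuclideanSpace ℝ (Fin N))) : LInf Ω →L[ℝ] L2 Ω →L[ℝ] L2 Ω :=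
  (ContinuousLinearMap.mul ℝ ℝ).holderL (volume.restrict Ω) ∞ 2 2

theorem coeFn_mulL (σ : LInf Ω) (u : L2 Ω) :
    mulL Ω σ u =ᵐ[volume.restrict Ω] fun x => σ x * u x :=
  (ContinuousLinearMap.mul ℝ ℝ).coeFn_holder σ u

theorem inner_mulL (σ : LInf Ω) (u v : L2 Ω) :
    ⟪mulL Ω σ u, v⟫_ℝ = ∫ x in Ω, σ x * (u x * v x) := by
  rw [L2.inner_def]
  refine integral_congr_ae ?_
  filter_upwards [coeFn_mulL σ u] with x hx
  simp only [hx, RCLike.inner_apply, conj_trivial]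
  ring

theorem mulL_symm (σ : LInf Ω) (u v : L2 Ω) : ⟪mulL Ω σ u, v⟫_ℝ = ⟪u, mulL Ω σ v⟫_ℝ := by
  rw [real_inner_comm (mulL Ω σ v) u, inner_mulL, inner_mulL]
  simp only [mul_comm]

theorem eigenspace_eq (ρ : LInf Ω) (l : ℝ) :
    eigenspace Ω w ρ l = IsCompactSymmetricGraph.ker (graph Ω w) (mulL Ω) ρ l := by
  have hval : ∀ u : L2 Ω, (-(mulL Ω ρ u + l • u) : L2 Ω) =ᵐ[volume.restrict Ω]
      fun x => -(ρ x * u x + l * u x) := by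
    intro u
    filter_upwards [Lp.coeFn_neg (mulL Ω ρ u + l • u), Lp.coeFn_add (mulL Ω ρ u) (l • u),
      Lp.coeFn_smul l u, coeFn_mulL ρ u] with x h1 h2 h3 h4
    simp only [h1, Pi.neg_apply, h2, Pi.add_apply, h3, Pi.smul_apply, h4, smul_eq_mul]
  ext u
  constructor
  · rintro ⟨f, hf, he⟩
    have e : f = -(mulL Ω ρ u + l • u) := by
      refine Lp.ext ?_
      filter_upwards [he, hval u] with x h1 h2
      rw [h2]
      linarith
    rw [e] at hf
    exact hf
  · intro h
    refine ⟨-(mulL Ω ρ u + l • u), h, ?_⟩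
    filter_upwards [hval u] with x hx
    rw [hx]
    ring

/-- A bounded function that does not act as a scalar on `E` exists as soon as `dim E ≥ 2`.
Otherwise indicator functions would show that two orthonormal members `u`, `v` of `E` satisfy
`u v = 0` and `u² = v²` almost everywhere, which forces `u = 0`. -/
theorem scalarOn_mulL_ne_top [IsFiniteMeasure (volume.restrict Ω)] (E : Submodule ℝ (L2 Ω))
    [FiniteDimensional ℝ E] (hE : 2 ≤ Module.finrank ℝ E) :
    IsCompactSymmetricGraph.scalarOn (mulL Ω) E ≠ ⊤ := by
  intro htop
  let b := stdOrthonormalBasis ℝ E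
  let u : L2 Ω := b ⟨0, by omega⟩
  let v : L2 Ω := b ⟨1, by omega⟩
  have hu : u ∈ E := (b _).2
  have hv : v ∈ E := (b _).2
  have huu : ⟪u, u⟫_ℝ = 1 := by
    rw [real_inner_self_eq_norm_sq, show ‖u‖ = 1 from b.orthonormal.1 _, one_pow]
  have hvv : ⟪v, v⟫_ℝ = 1 := by
    rw [real_inner_self_eq_norm_sq, show ‖v‖ = 1 from b.orthonormal.1 _, one_pow]
  have huv : ⟪u, v⟫_ℝ = 0 := b.orthonormal.2 (by simp)
  have hi : ∀ p q : L2 Ω, Integrable (fun x => p x * q x) (volume.restrict Ω) := fun p q =>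
    (L2.integrable_inner (𝕜 := ℝ) p q).congr (ae_of_all _ fun x => by simp [mul_comm])
  have hset : ∀ s, MeasurableSet s →
      ∫ x in s, u x * v x ∂(volume.restrict Ω) = 0 ∧
        ∫ x in s, u x * u x ∂(volume.restrict Ω) = ∫ x in s, v x * v x ∂(volume.restrict Ω) := by
    intro s hs
    let σ : LInf Ω := indicatorConstLp ∞ hs (measure_ne_top _ s) (1 : ℝ)
    have hσ : ∀ p q : L2 Ω, ⟪mulL Ω σ p, q⟫_ℝ = ∫ x in s, p x * q x ∂(volume.restrict Ω) := by
      intro p q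
      rw [inner_mulL, ← integral_indicator hs]
      refine integral_congr_ae ?_
      filter_upwards [indicatorConstLp_coeFn (p := ∞) (hs := hs)
        (hμs := measure_ne_top (volume.restrict Ω) s) (c := (1 : ℝ))] with x hx
      simp only [σ, hx]
      by_cases hxs : x ∈ s <;> simp [hxs]
    obtain ⟨μ, hμ⟩ : σ ∈ IsCompactSymmetricGraph.scalarOn (mulL Ω) E := htop ▸ trivial
    rw [← hσ, ← hσ, ← hσ, hμ u hu v hv, hμ u hu u hu, hμ v hv v hv, huu, hvv, huv]
    simp
  have h1 := (hi u v).ae_eq_zero_of_forall_setIntegral_eq_zero fun s hs _ => (hset s hs).1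
  have h2 := ((hi u u).sub (hi v v)).ae_eq_zero_of_forall_setIntegral_eq_zero fun s hs _ => by
    simp only [Pi.sub_apply]
    rw [integral_sub (hi u u).restrict (hi v v).restrict, (hset s hs).2, sub_self]
  have h0 : ⟪u, u⟫_ℝ = 0 := by
    rw [L2.inner_def]
    refine integral_eq_zero_of_ae ?_
    filter_upwards [h1, h2] with x hx1 hx2
    simp only [Pi.zero_apply, Pi.sub_apply] at hx1 hx2
    have : u x = 0 := by
      rcases mul_eq_zero.1 hx1 with h | h
      · exact h
      · rw [h] at hx2
        simpa using hx2
    simp [this]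
  rw [huu] at h0
  exact one_ne_zero h0

end DegenerateElliptic

/-! ### Generic simplicity -/

theorem theorem4p3 {N : ℕ} (hN : 0 < N) (Ω : Set (EuclideanSpace ℝ (Fin N)))
    (hΩ : DegenerateElliptic.IsBoundedSmoothDomain Ω)
    (w : EuclideanSpace ℝ (Fin N) → ℝ) (hwc : ContinuousOn w (closure Ω))
    (hws : ContDiffOn ℝ ∞ w Ω) (hwA : DegenerateElliptic.IsA2WeightOn Ω w)
    (hwpos : ∀ x ∈ Ω, 0 < w x)
    (Γ : Set (EuclideanSpace ℝ (Fin N))) (hΓ : Γ ⊆ frontier Ω)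
    (hΓ' : (∃ O : Set (EuclideanSpace ℝ (Fin N)), IsOpen O ∧ Γ = O ∩ frontier Ω) ∨
      ∃ x₀, Γ = {x₀})
    (hwΓ : ∀ x ∈ Γ, w x = 0)
    (hPoincare : DegenerateElliptic.PoincareInequality Ω w)
    (hW11 : DegenerateElliptic.EmbedsContinuouslyW11 Ω w)
    (hCompact : DegenerateElliptic.EmbedsCompactlyL2 Ω w) :
    ∃ U : ℕ → Set (DegenerateElliptic.LInf Ω),
      (∀ n, IsOpen (U n) ∧ Dense (U n)) ∧
        ⋂ n, U n ⊆ {ρ | DegenerateElliptic.HasSimpleEigenvalues Ω w ρ} := by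
  have hw : DegenerateElliptic.IsInteriorPositive Ω w := ⟨hΩ.isOpen, hΩ.isBounded, hwc, hwpos⟩
  have hA := hw.isCompactSymmetricGraph hCompact
  have := hw.isFiniteMeasure_restrict
  refine ⟨fun n => IsCompactSymmetricGraph.multLE (DegenerateElliptic.graph Ω w)
    (DegenerateElliptic.mulL Ω) n 1, fun n => ⟨hA.isOpen_multLE n 1, hA.dense_multLE_one
      DegenerateElliptic.mulL_symm
      (fun E _ hE => DegenerateElliptic.scalarOn_mulL_ne_top E hE) n⟩, ?_⟩
  intro ρ hρ l hl
  obtain ⟨n, hn⟩ := exists_nat_ge |l|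
  have h1 := mem_iInter.1 hρ n l (abs_le.1 hn)
  rw [DegenerateElliptic.IsEigenvalue] at hl
  rw [DegenerateElliptic.eigenspace_eq] at hl ⊢
  have := hA.finiteDimensional_ker (M := DegenerateElliptic.mulL Ω) ρ l
  exact le_antisymm h1 (Submodule.one_le_finrank_iff.2 hl)
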